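/- A weighted graph $G=(V,w)$ on the vertex set $V=\{1,\dots,n\}$ consists of a weight function $w:V^{(2)}\to\mathbb{R}$ with $w\ge 0$ on the set $V^{(2)}$ of two-element subsets of $V$; its edges are the $e\in V^{(2)}$ with $w(e)>0$. Its adjacency matrix $A\in\mathbb{R}^{n\times n}$ has $A(u,v)=w(\{u,v\})$ for $u\ne v$ and zero diagonal. A spanning forest of $G$ is an acyclic set of edges of $G$ that connects any two vertices connected in $G$. A deterministic matrix-vector multiplication query algorithm adaptively queries vectors $x\in\{0,1\}^n$, receives the answer $Ax\in\mathbb{R}^n$ to each query, and finally produces an output; only queries are counted. A randomized algorithm is a probability distribution over deterministic ones. There is a constant $C$ such that for every $n$ there is a randomized matrix-vector multiplication query algorithm with the following property. For every $n$-vertex weighted graph $G$, run on the adjacency matrix of $G$, the algorithm always makes at most $C\,(\log n)^4$ queries, and it outputs a spanning forest of $G$ with probability at least $49/50$. -/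

import Mathlib

/-- A weighted undirected graph on the vertex set `V`: every edge slot, that is every two-element
subset of `V`, carries a nonnegative real weight. -/
structure WeightedGraph (V : Type*) where
  /-- the weight function on the edge slots -/
  weight : {e : Sym2 V // ¬ e.IsDiag} → ℝ
  weight_nonneg : ∀ e, 0 ≤ weight e

namespace WeightedGraph

/-- The graph whose edges are the edge slots of positive weight. -/
def graph {V : Type*} (G : WeightedGraph V) : SimpleGraph V where
  Adj u v := ∃ h : u ≠ v, 0 < G.weight ⟨s(u, v), by simpa using h⟩
  symm := ⟨by
    rintro u v ⟨h, hw⟩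
    refine ⟨h.symm, ?_⟩
    have key : (⟨s(v, u), by simpa using h.symm⟩ : {e : Sym2 V // ¬ e.IsDiag}) =
        ⟨s(u, v), by simpa using h⟩ := Subtype.ext Sym2.eq_swap
    rw [key]
    exact hw⟩
  loopless := ⟨fun _ h => h.1 rfl⟩

/-- The adjacency matrix: the entry at `(u, v)` is the weight of the slot `{u, v}` if `u ≠ v`,
and the diagonal is zero. -/
def adjMatrix {V : Type*} [DecidableEq V] (G : WeightedGraph V) : Matrix V V ℝ :=
  Matrix.of fun u v => if h : u = v then 0 else G.weight ⟨s(u, v), by simpa using h⟩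

end WeightedGraph

/-- `F` is a spanning forest of `G`: an acyclic subgraph of `G`, on the same vertices, that
connects any two vertices that are connected in `G`. Equivalently, it consists of one
spanning tree for each connected component of `G`. -/
def IsSpanningForest {V : Type*} (F G : SimpleGraph V) : Prop :=
  F ≤ G ∧ F.IsAcyclic ∧ ∀ u v, G.Reachable u v → F.Reachable u v

/-- A deterministic adaptive algorithm (decision tree) with matrix-vector multiplication queries
to an unknown real `n × n` matrix. It either stops with an output, or queries a vector
`x ∈ {0,1}ⁿ` and continues depending on the answer, a vector in `ℝⁿ`. -/
inductive MatVecAlg (n : ℕ) (Out : Type) : Type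
  | output (a : Out) : MatVecAlg n Out
  | query (x : Fin n → Bool) (next : (Fin n → ℝ) → MatVecAlg n Out) : MatVecAlg n Out

namespace MatVecAlg

/-- The answer `A x` to the query `x ∈ {0,1}ⁿ`. -/
def answer {n : ℕ} (A : Matrix (Fin n) (Fin n) ℝ) (x : Fin n → Bool) : Fin n → ℝ :=
  A.mulVec fun i => if x i then 1 else 0

/-- The output of the algorithm when the unknown matrix is `A`. -/
noncomputable def run {n : ℕ} {Out : Type} (A : Matrix (Fin n) (Fin n) ℝ) :
    MatVecAlg n Out → Out
  | output a => a
  | query x next => run A (next (answer A x))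

/-- The number of queries the algorithm makes when the unknown matrix is `A`. -/
noncomputable def queryCount {n : ℕ} {Out : Type} (A : Matrix (Fin n) (Fin n) ℝ) :
    MatVecAlg n Out → ℕ
  | output _ => 0
  | query x next => queryCount A (next (answer A x)) + 1

end MatVecAlg

/-- A randomized algorithm with matrix-vector multiplication queries: a (discrete) probability
distribution over deterministic algorithms. -/
abbrev RandomizedMatVecAlg (n : ℕ) (Out : Type) : Type := PMF (MatVecAlg n Out)

/-!
The algorithm is a randomized form of Borůvka's algorithm. It keeps a graph `H` of known edges of the
unknown graph `G`. In a round every component of `H` gets a random colour. The vertices of the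
components of colour `true` are sampled, each with the same random probability `2 ^ i / 2 ^ (L + 1)`,
where `L = Nat.log 2 n + 1` and `i < L`. As the weights are nonnegative, a query answers for
all vertices at once whether they have a neighbour in the queried set. Hence the `2 L` queries of the
sampled set, restricted to the vertices with a given value of a given bit, reveal for every vertex
whether it has exactly one sampled neighbour, and which one it is (`decodes_iff`). The edges found in
this way from components of colour `false` are added to `H`. Since they end in components of the other
colour, no edge inside a component gets in the way.

The progress is measured by the number of unfinished components of `H`, those that an edge of `G`
leaves. An unfinished component of colour `false` that finds an edge is absorbed by an unfinished
component of colour `true`, so it no longer counts (`unfinishedCount_roundResult_le`). This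
happens with probability at least `1 / (32 L)`: the two ends of a leaving edge get the right colours
with probability `1 / 4`, the level `i` suits the number of available neighbours with
probability `1 / L`, and a second moment bound gives a unique sampled neighbour with
probability `1 / 8` (`card_roundSeed_le_mul_card_merges`). So the expected number of unfinished
components drops by the factor `1 - 1 / (32 L)` in every round, and after `32 L (L + 6)` rounds it
is at most `1 / 50`. By Markov's inequality `H` then has the components of `G` with
probability `49 / 50`, and a spanning forest of `H` is one of `G`. The number of queries is
`64 L² (L + 6)`, which is even of order `(log n) ^ 3`.
-/

/-! ### Answers to queries -/

namespace WeightedGraph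

lemma adjMatrix_nonneg {V : Type*} [DecidableEq V] (G : WeightedGraph V) (u v : V) :
    0 ≤ G.adjMatrix u v := by
  unfold adjMatrix
  rw [Matrix.of_apply]
  split_ifs
  · exact le_rfl
  · exact G.weight_nonneg _

lemma adjMatrix_pos_iff {V : Type*} [DecidableEq V] (G : WeightedGraph V) (u v : V) :
    0 < G.adjMatrix u v ↔ G.graph.Adj u v := by
  unfold adjMatrix graph
  rw [Matrix.of_apply]
  by_cases h : u = v <;> simp [h]

end WeightedGraph

lemma MatVecAlg.answer_eq_zero_iff {n : ℕ} (G : WeightedGraph (Fin n)) (x : Fin n → Bool)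
    (v : Fin n) :
    answer G.adjMatrix x v = 0 ↔ ∀ u, x u = true → ¬ G.graph.Adj v u := by
  unfold answer Matrix.mulVec dotProduct
  rw [Finset.sum_eq_zero_iff_of_nonneg fun u _ =>
    mul_nonneg (G.adjMatrix_nonneg v u) (by split_ifs <;> norm_num)]
  refine ⟨fun h u hu hadj => ?_, fun h u _ => ?_⟩
  · have := h u (Finset.mem_univ u)
    rw [if_pos hu, mul_one] at this
    exact ((G.adjMatrix_pos_iff v u).2 hadj).ne' this
  · by_cases hu : x u = true
    · have : ¬ 0 < G.adjMatrix v u := fun hp => h u hu ((G.adjMatrix_pos_iff v u).1 hp)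
      rw [le_antisymm (not_lt.1 this) (G.adjMatrix_nonneg v u), zero_mul]
    · rw [if_neg hu, mul_zero]

/-! ### Batches of queries -/

namespace MatVecAlg

/-- Makes the queries of a list `l` and continues with the table of the answers. A vector that
does not occur in `l` has the entry `0` in the table. -/
noncomputable def queryList {n : ℕ} {Out : Type} :
    List (Fin n → Bool) → (((Fin n → Bool) → Fin n → ℝ) → MatVecAlg n Out) → MatVecAlg n Out
  | [], next => next fun _ => 0
  | x :: l, next => query x fun a => queryList l fun f => next (Function.update f x a)

/-- The table of the answers to the queries of `l` when the unknown matrix is `A`. -/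
noncomputable def answerTable {n : ℕ} (A : Matrix (Fin n) (Fin n) ℝ) (l : List (Fin n → Bool)) :
    (Fin n → Bool) → Fin n → ℝ :=
  fun x => if x ∈ l then answer A x else 0

lemma answerTable_nil {n : ℕ} (A : Matrix (Fin n) (Fin n) ℝ) :
    answerTable A [] = fun _ => 0 := by
  funext x
  simp [answerTable]

lemma update_answerTable {n : ℕ} (A : Matrix (Fin n) (Fin n) ℝ) (x : Fin n → Bool)
    (l : List (Fin n → Bool)) :
    Function.update (answerTable A l) x (answer A x) = answerTable A (x :: l) := by
  funext y
  by_cases h : y = x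
  · subst h; simp [answerTable]
  · simp [answerTable, h]

lemma run_queryList {n : ℕ} {Out : Type} (A : Matrix (Fin n) (Fin n) ℝ)
    (l : List (Fin n → Bool)) (next : ((Fin n → Bool) → Fin n → ℝ) → MatVecAlg n Out) :
    run A (queryList l next) = run A (next (answerTable A l)) := by
  induction l generalizing next with
  | nil => rw [queryList, answerTable_nil]
  | cons x l ih => rw [queryList, run, ih, update_answerTable]

lemma queryCount_queryList {n : ℕ} {Out : Type} (A : Matrix (Fin n) (Fin n) ℝ)
    (l : List (Fin n → Bool)) (next : ((Fin n → Bool) → Fin n → ℝ) → MatVecAlg n Out) :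
    queryCount A (queryList l next) = queryCount A (next (answerTable A l)) + l.length := by
  induction l generalizing next with
  | nil => rw [queryList, answerTable_nil, List.length_nil, add_zero]
  | cons x l ih => rw [queryList, queryCount, ih, update_answerTable, List.length_cons]; ring

end MatVecAlg

/-! ### Decoding a unique sampled neighbour -/

/-- The vertices of `x` whose bit number `b` equals `β`. -/
def bitSlice {n : ℕ} (x : Fin n → Bool) (b : ℕ) (β : Bool) : Fin n → Bool :=
  fun u => x u && (u.val.testBit b == β)

/-- The queries that identify, for every vertex at once, a unique neighbour in `x`. -/
def sliceQueries {n : ℕ} (L : ℕ) (x : Fin n → Bool) : List (Fin n → Bool) :=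
  (List.range L).flatMap fun b => [bitSlice x b true, bitSlice x b false]

lemma length_sliceQueries {n : ℕ} (L : ℕ) (x : Fin n → Bool) :
    (sliceQueries L x).length = 2 * L := by
  simp [sliceQueries, List.length_flatMap, mul_comm]

lemma bitSlice_mem_sliceQueries {n L b : ℕ} (x : Fin n → Bool) (hb : b < L) (β : Bool) :
    bitSlice x b β ∈ sliceQueries L x := by
  refine List.mem_flatMap.2 ⟨b, List.mem_range.2 hb, ?_⟩
  cases β <;> simp

/-- What the table `f` of answers has to look like for `u` to be announced as the only neighbour
of `v` in `x`: for every bit, exactly the slice of `x` that contains `u` has a neighbour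
of `v`. -/
def Decodes {n : ℕ} (L : ℕ) (x : Fin n → Bool) (f : (Fin n → Bool) → Fin n → ℝ) (v u : Fin n) :
    Prop :=
  x u = true ∧ ∀ b < L, f (bitSlice x b (u.val.testBit b)) v ≠ 0 ∧
    f (bitSlice x b (!u.val.testBit b)) v = 0

/-- `u` is the only neighbour of `v` in `x`. -/
def IsUniqueNeighbor {n : ℕ} (G : SimpleGraph (Fin n)) (x : Fin n → Bool) (v u : Fin n) : Prop :=
  x u = true ∧ G.Adj v u ∧ ∀ u', x u' = true → G.Adj v u' → u' = u

/-- Two different neighbours in `x` would differ in some bit, and then both slices of that bit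
would contain a neighbour. -/
lemma decodes_iff {n L : ℕ} (hL : 0 < L) (hn : n ≤ 2 ^ L) (G : WeightedGraph (Fin n))
    (x : Fin n → Bool) (v u : Fin n) :
    Decodes L x (MatVecAlg.answerTable G.adjMatrix (sliceQueries L x)) v u ↔
      IsUniqueNeighbor G.graph x v u := by
  have table : ∀ b < L, ∀ β, MatVecAlg.answerTable G.adjMatrix (sliceQueries L x)
      (bitSlice x b β) v = 0 ↔
      ∀ w, x w = true → w.val.testBit b = β → ¬ G.graph.Adj v w := by
    intro b hb β
    rw [MatVecAlg.answerTable, if_pos (bitSlice_mem_sliceQueries x hb β),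
      MatVecAlg.answer_eq_zero_iff]
    simp [bitSlice]
  constructor
  · rintro ⟨hu, h⟩
    have huniq : ∀ u', x u' = true → G.graph.Adj v u' → u' = u := by
      intro u' hu' hadj
      refine Fin.ext (Nat.eq_of_testBit_eq fun b => ?_)
      by_cases hb : b < L
      · by_contra hne
        exact (table b hb _).1 (h b hb).2 u' hu' (by grind) hadj
      · have hpow : 2 ^ L ≤ 2 ^ b := Nat.pow_le_pow_right two_pos (not_lt.1 hb)
        rw [Nat.testBit_lt_two_pow (by omega), Nat.testBit_lt_two_pow (by omega)]
    refine ⟨hu, ?_, huniq⟩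
    have h0 := (h 0 hL).1
    rw [Ne, table 0 hL] at h0
    push Not at h0
    obtain ⟨w, hw, -, hadj⟩ := h0
    exact huniq w hw hadj ▸ hadj
  · rintro ⟨hu, hadj, huniq⟩
    refine ⟨hu, fun b hb => ⟨fun h0 => (table b hb _).1 h0 u hu rfl hadj, ?_⟩⟩
    rw [table b hb]
    intro w hw hbit hw'
    rw [huniq w hw hw'] at hbit
    simp at hbit

/-! ### One round -/

/-- The random choices of one round: a colouring of the vertices, of which only the colours of
the component representatives matter, a random height for every vertex, and a sampling level. -/
abbrev RoundSeed (n L : ℕ) : Type := (Fin n → Bool) × (Fin n → Fin (2 ^ (L + 1))) × Fin L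

/-- The colour of the component of `v` in `H`, given by the colour of its representative. -/
noncomputable def componentColor {n : ℕ} (H : SimpleGraph (Fin n)) (c : Fin n → Bool)
    (v : Fin n) : Bool :=
  c (Quot.out (H.connectedComponentMk v))

/-- The sampled vertices: those in components of colour `true` whose height is
below `2 ^ i`, for the level `i`. -/
noncomputable def sample {n L : ℕ} (H : SimpleGraph (Fin n)) (s : RoundSeed n L) :
    Fin n → Bool :=
  fun u => componentColor H s.1 u && decide ((s.2.1 u).val < 2 ^ s.2.2.val)

/-- The known edges after a round: a vertex in a component of colour `false` gets the edge to the
sampled neighbour announced for it by the answers. -/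
noncomputable def updateEdges {n L : ℕ} (H : SimpleGraph (Fin n)) (s : RoundSeed n L)
    (f : (Fin n → Bool) → Fin n → ℝ) : SimpleGraph (Fin n) :=
  H ⊔ SimpleGraph.fromRel fun v u => componentColor H s.1 v = false ∧ Decodes L (sample H s) f v u

/-- The known edges after a round, in terms of the unknown graph `G`. -/
noncomputable def roundResult {n L : ℕ} (G H : SimpleGraph (Fin n)) (s : RoundSeed n L) :
    SimpleGraph (Fin n) :=
  H ⊔ SimpleGraph.fromRel fun v u =>
    componentColor H s.1 v = false ∧ IsUniqueNeighbor G (sample H s) v u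

lemma updateEdges_answerTable {n L : ℕ} (hL : 0 < L) (hn : n ≤ 2 ^ L) (G : WeightedGraph (Fin n))
    (H : SimpleGraph (Fin n)) (s : RoundSeed n L) :
    updateEdges H s (MatVecAlg.answerTable G.adjMatrix (sliceQueries L (sample H s))) =
      roundResult G.graph H s := by
  simp only [updateEdges, roundResult, decodes_iff hL hn]

lemma roundResult_le {n L : ℕ} {G H : SimpleGraph (Fin n)} (hH : H ≤ G) (s : RoundSeed n L) :
    roundResult G H s ≤ G := by
  refine sup_le hH fun a b hab => ?_
  rw [SimpleGraph.fromRel_adj] at hab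
  rcases hab.2 with h | h
  · exact h.2.2.1
  · exact h.2.2.1.symm

/-! ### Unfinished components -/

/-- A component of `H` that an edge of `G` leaves. -/
def Unfinished {V : Type*} (G H : SimpleGraph V) (C : H.ConnectedComponent) : Prop :=
  ∃ v u, G.Adj v u ∧ H.connectedComponentMk v = C ∧ H.connectedComponentMk u ≠ C

/-- The component has colour `false` and one of its vertices has a unique sampled neighbour, so that
the round joins it to a component of colour `true`. -/
def Merges {n L : ℕ} (G H : SimpleGraph (Fin n)) (s : RoundSeed n L)
    (C : H.ConnectedComponent) : Prop :=
  ∃ v u, H.connectedComponentMk v = C ∧ componentColor H s.1 v = false ∧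
    IsUniqueNeighbor G (sample H s) v u

open Classical in
/-- The number of components of `H` that are not yet components of `G`. -/
noncomputable def unfinishedCount {n : ℕ} (G H : SimpleGraph (Fin n)) : ℕ :=
  (Finset.univ.filter fun C : H.ConnectedComponent => Unfinished G H C).card

lemma unfinishedCount_le {n : ℕ} (G H : SimpleGraph (Fin n)) : unfinishedCount G H ≤ n := by
  classical
  refine (Finset.card_le_univ _).trans ?_
  have := Fintype.card_le_of_surjective H.connectedComponentMk Quot.mk_surjective
  rwa [Fintype.card_fin] at this

lemma reachable_of_unfinishedCount_eq_zero {n : ℕ} {G H : SimpleGraph (Fin n)}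
    (h : unfinishedCount G H = 0) {u v : Fin n} (huv : G.Reachable u v) : H.Reachable u v := by
  classical
  have hadj : ∀ a b, G.Adj a b → H.Reachable a b := by
    intro a b hab
    by_contra hne
    have := Finset.card_eq_zero.1 h
    refine Finset.notMem_empty (H.connectedComponentMk a) (this ▸ ?_)
    refine Finset.mem_filter.2 ⟨Finset.mem_univ _, a, b, hab, rfl, fun h' => hne ?_⟩
    exact (SimpleGraph.ConnectedComponent.exact h').symm
  obtain ⟨p⟩ := huv
  induction p with
  | nil => exact SimpleGraph.Reachable.refl _
  | cons hab _ ih => exact (hadj _ _ hab).trans ih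

lemma componentColor_eq_of_sample {n L : ℕ} {H : SimpleGraph (Fin n)} {s : RoundSeed n L}
    {u : Fin n} (h : sample H s u = true) : componentColor H s.1 u = true := by
  simp only [sample, Bool.and_eq_true] at h
  exact h.1

open Classical in
/-- Every unfinished component after the round contains an unfinished component from before the
round that does not merge: a merging component comes with the component of colour `true` that it is
joined to. -/
lemma unfinishedCount_roundResult_le {n L : ℕ} (G H : SimpleGraph (Fin n)) (s : RoundSeed n L) :
    unfinishedCount G (roundResult G H s) ≤
      (Finset.univ.filter fun C : H.ConnectedComponent =>
        Unfinished G H C ∧ ¬ Merges G H s C).card := by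
  have hle : H ≤ roundResult G H s := le_sup_left
  unfold unfinishedCount
  refine le_trans (Finset.card_le_card ?_) (Finset.card_image_le
    (f := SimpleGraph.ConnectedComponent.map (SimpleGraph.Hom.ofLE hle)))
  intro D hD
  obtain ⟨-, v, u, hadj, rfl, hu⟩ := Finset.mem_filter.1 hD
  rw [Finset.mem_image]
  by_cases hm : Merges G H s (H.connectedComponentMk v)
  · obtain ⟨v', u', hv', hcol, huniq⟩ := hm
    have hcol' := componentColor_eq_of_sample huniq.1
    refine ⟨H.connectedComponentMk u', ?_, ?_⟩
    · refine Finset.mem_filter.2 ⟨Finset.mem_univ _, ⟨u', v', huniq.2.1.symm, rfl, ?_⟩, ?_⟩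
      · intro h
        simp [componentColor, h] at hcol hcol'
        simp [hcol] at hcol'
      · rintro ⟨a, b, ha, hacol, -⟩
        simp only [componentColor, ha] at hacol hcol'
        simp [hacol] at hcol'
    · have h1 : (roundResult G H s).Adj v' u' :=
        Or.inr ((SimpleGraph.fromRel_adj _ _ _).2 ⟨huniq.2.1.ne, Or.inl ⟨hcol, huniq⟩⟩)
      have h2 : H.Reachable v' v := SimpleGraph.ConnectedComponent.exact hv'
      exact SimpleGraph.ConnectedComponent.sound (h1.symm.reachable.trans (h2.mono hle))
  · refine ⟨H.connectedComponentMk v, ?_, rfl⟩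
    refine Finset.mem_filter.2 ⟨Finset.mem_univ _, ⟨v, u, hadj, rfl, fun h => hu ?_⟩, hm⟩
    exact SimpleGraph.ConnectedComponent.sound
      ((SimpleGraph.ConnectedComponent.exact h).mono hle)

/-! ### Uniformly random functions -/

section RandomFunction

variable {ι β : Type*} [Fintype ι] [DecidableEq ι] [Fintype β] [DecidableEq β] [Nonempty β]

lemma card_filter_forall_mem (t : ι → Finset β) :
    ((Finset.univ.filter fun h : ι → β => ∀ x, h x ∈ t x).card : ℝ) =
      (∏ x, ((t x).card / Fintype.card β : ℝ)) * (Fintype.card β : ℝ) ^ Fintype.card ι := by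
  have h1 : (Finset.univ.filter fun h : ι → β => ∀ x, h x ∈ t x) = Fintype.piFinset t := by
    ext h; simp
  have h2 : (Fintype.card β : ℝ) ≠ 0 := by exact_mod_cast Fintype.card_ne_zero
  rw [h1, Fintype.card_piFinset, Finset.prod_div_distrib, Finset.prod_const, Finset.card_univ,
    div_mul_cancel₀ _ (pow_ne_zero _ h2)]
  push_cast
  rfl

lemma card_filter_apply_mem (w : ι) (B : Finset β) :
    ((Finset.univ.filter fun h : ι → β => h w ∈ B).card : ℝ) =
      (B.card / Fintype.card β : ℝ) * (Fintype.card β : ℝ) ^ Fintype.card ι := by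
  have h2 : (Fintype.card β : ℝ) ≠ 0 := by exact_mod_cast Fintype.card_ne_zero
  have h := card_filter_forall_mem (fun x : ι => if x = w then B else Finset.univ)
  rw [Finset.prod_eq_single w (fun x _ hx => by simp [hx, h2]) (by simp), if_pos rfl] at h
  rw [← h]
  congr 2
  ext f
  simp only [Finset.mem_filter, Finset.mem_univ, true_and]
  grind

lemma card_filter_apply_mem_and_apply_mem {w w' : ι} (hw : w ≠ w') (B B' : Finset β) :
    ((Finset.univ.filter fun h : ι → β => h w ∈ B ∧ h w' ∈ B').card : ℝ) =
      (B.card / Fintype.card β : ℝ) * (B'.card / Fintype.card β : ℝ) *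
        (Fintype.card β : ℝ) ^ Fintype.card ι := by
  have h2 : (Fintype.card β : ℝ) ≠ 0 := by exact_mod_cast Fintype.card_ne_zero
  have h := card_filter_forall_mem
    (fun x : ι => if x = w then B else if x = w' then B' else Finset.univ)
  rw [Finset.prod_eq_mul w w' hw (fun x _ hx => by simp [hx, h2]) (by simp) (by simp), if_pos rfl,
    if_neg hw.symm, if_pos rfl] at h
  rw [← h]
  congr 2
  ext f
  simp only [Finset.mem_filter, Finset.mem_univ, true_and]
  grind

/-- A random function maps exactly one element of `N` into `B` with probability at least `x - x²`,
where `x` is the expectation of the number `X` of such elements. This follows from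
`1_{X = 1} ≥ 2 X - X²` and the pairwise independence of the values. -/
lemma le_card_filter_card_eq_one (N : Finset ι) (B : Finset β) {x : ℝ}
    (hx : x = N.card * (B.card / Fintype.card β : ℝ)) :
    (x - x ^ 2) * (Fintype.card β : ℝ) ^ Fintype.card ι ≤
      ((Finset.univ.filter fun h : ι → β => (N.filter fun w => h w ∈ B).card = 1).card : ℝ) := by
  set q : ℝ := B.card / Fintype.card β with hq
  set M : ℝ := (Fintype.card β : ℝ) ^ Fintype.card ι with hM
  have hM0 : 0 ≤ M := by positivity
  have hX : ∀ h : ι → β, ((N.filter fun w => h w ∈ B).card : ℝ) =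
      ∑ w ∈ N, if h w ∈ B then (1 : ℝ) else 0 := by
    intro h
    rw [Finset.card_filter]
    push_cast
    rfl
  have first : ∑ h : ι → β, ((N.filter fun w => h w ∈ B).card : ℝ) = x * M := by
    simp_rw [hX]
    rw [Finset.sum_comm, hx, mul_assoc, ← nsmul_eq_mul]
    refine Finset.sum_eq_card_nsmul fun w _ => ?_
    rw [← card_filter_apply_mem w B, Finset.card_filter]
    push_cast
    rfl
  have second : ∑ h : ι → β, ((N.filter fun w => h w ∈ B).card : ℝ) ^ 2 ≤ (x + x ^ 2) * M := by
    have pair : ∀ w w' : ι, ∑ h : ι → β,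
        (if h w ∈ B then (1 : ℝ) else 0) * (if h w' ∈ B then (1 : ℝ) else 0) ≤
          (if w = w' then q * M else 0) + q ^ 2 * M := by
      intro w w'
      have hand : ∀ h : ι → β,
          (if h w ∈ B then (1 : ℝ) else 0) * (if h w' ∈ B then (1 : ℝ) else 0) =
            if h w ∈ B ∧ h w' ∈ B then 1 else 0 := by
        intro h
        by_cases h1 : h w ∈ B <;> by_cases h2 : h w' ∈ B <;> simp [h1, h2]
      simp_rw [hand]
      rw [← Finset.natCast_card_filter]
      by_cases hw : w = w'
      · subst hw
        simp only [and_self, if_true]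
        rw [card_filter_apply_mem w B]
        have : 0 ≤ q ^ 2 * M := by positivity
        linarith
      · rw [card_filter_apply_mem_and_apply_mem hw, if_neg hw, zero_add, sq]
    simp_rw [hX, sq, Finset.sum_mul_sum]
    rw [Finset.sum_comm]
    have swap : ∀ w ∈ N, ∑ h : ι → β, ∑ w' ∈ N,
        (if h w ∈ B then (1 : ℝ) else 0) * (if h w' ∈ B then (1 : ℝ) else 0) ≤
          q * M + N.card * (q ^ 2 * M) := by
      intro w hw
      rw [Finset.sum_comm]
      refine (Finset.sum_le_sum fun w' _ => pair w w').trans_eq ?_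
      rw [Finset.sum_add_distrib, Finset.sum_ite_eq, if_pos hw, Finset.sum_const, nsmul_eq_mul]
    refine (Finset.sum_le_sum swap).trans_eq ?_
    rw [Finset.sum_const, nsmul_eq_mul, hx]
    ring
  calc (x - x ^ 2) * M = 2 * (x * M) - (x + x ^ 2) * M := by ring
    _ ≤ 2 * ∑ h : ι → β, ((N.filter fun w => h w ∈ B).card : ℝ) -
        ∑ h : ι → β, ((N.filter fun w => h w ∈ B).card : ℝ) ^ 2 := by rw [first]; linarith
    _ = ∑ h : ι → β, (2 * ((N.filter fun w => h w ∈ B).card : ℝ) -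
        ((N.filter fun w => h w ∈ B).card : ℝ) ^ 2) := by
      rw [Finset.sum_sub_distrib, Finset.mul_sum]
    _ ≤ _ := by
      rw [Finset.natCast_card_filter]
      refine Finset.sum_le_sum fun h _ => ?_
      generalize (N.filter fun w => h w ∈ B).card = X
      split_ifs with h1
      · subst h1; norm_num
      · rcases Nat.lt_or_gt_of_ne h1 with h0 | h2
        · rw [Nat.lt_one_iff.1 h0]; norm_num
        · have : (2 : ℝ) ≤ X := by exact_mod_cast h2
          nlinarith

end RandomFunction

/-- Among the levels there is one at which the expected number of elements of `N` of height
below `2 ^ i` lies between `1/4` and `1/2`. -/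
lemma exists_level {ι : Type*} [Fintype ι] [DecidableEq ι] {L : ℕ} (N : Finset ι)
    (hN : N.Nonempty) (hNL : N.card < 2 ^ L) :
    ∃ i : Fin L, ((2 : ℝ) ^ (L + 1)) ^ Fintype.card ι ≤
      8 * ((Finset.univ.filter fun h : ι → Fin (2 ^ (L + 1)) =>
        (N.filter fun w => (h w).val < 2 ^ i.val).card = 1).card : ℝ) := by
  set k := Nat.log 2 N.card with hk
  have hd : N.card ≠ 0 := hN.card_pos.ne'
  have h1 : 2 ^ k ≤ N.card := Nat.pow_log_le_self 2 hd
  have h2 : N.card < 2 ^ (k + 1) := Nat.lt_pow_succ_log_self one_lt_two _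
  have hkL : k < L := (Nat.pow_lt_pow_iff_right one_lt_two).1 (h1.trans_lt hNL)
  -- A height is below `2 ^ (L - 1 - k)` with probability `2 ^ (-(k + 2))`, where
  -- `2 ^ k ≤ #N < 2 ^ (k + 1)`.
  refine ⟨⟨L - 1 - k, by omega⟩, ?_⟩
  set B : Finset (Fin (2 ^ (L + 1))) := Finset.univ.filter fun a => a.val < 2 ^ (L - 1 - k) with hB
  have hBc : B.card = 2 ^ (L - 1 - k) := by
    rw [hB, Fin.card_filter_val_lt, min_eq_right]
    exact Nat.pow_le_pow_right two_pos (by omega)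
  have key := le_card_filter_card_eq_one N B rfl
  simp only [hB, Finset.mem_filter, Finset.mem_univ, true_and] at key
  rw [← hB, hBc, Fintype.card_fin] at key
  push_cast at key
  set x : ℝ := N.card * (2 ^ (L - 1 - k) / 2 ^ (L + 1)) with hx
  have hq : (2 : ℝ) ^ (L - 1 - k) / 2 ^ (L + 1) = 1 / (4 * 2 ^ k) := by
    rw [div_eq_div_iff (by positivity) (by positivity), one_mul]
    rw [show (4 : ℝ) = 2 ^ 2 by norm_num, ← pow_add, ← pow_add]
    congr 1
    omega
  have h1' : (2 : ℝ) ^ k ≤ N.card := by exact_mod_cast h1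
  have h2' : (N.card : ℝ) ≤ 2 * 2 ^ k := by
    rw [← pow_succ']; exact_mod_cast h2.le
  have hx1 : 1 / 4 ≤ x := by
    rw [hx, hq, mul_one_div, div_le_div_iff₀ (by norm_num) (by positivity)]
    linarith
  have hx2 : x ≤ 1 / 2 := by
    rw [hx, hq, mul_one_div, div_le_div_iff₀ (by positivity) (by norm_num)]
    linarith
  have hM : (0 : ℝ) ≤ ((2 : ℝ) ^ (L + 1)) ^ Fintype.card ι := by positivity
  have h8 : (1 / 8 : ℝ) ≤ x - x ^ 2 := by nlinarith
  nlinarith [mul_le_mul_of_nonneg_right h8 hM]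

open Classical in
/-- An unfinished component merges with probability at least `1 / (32 L)`: with probability `1/4` it
has colour `false` and an edge leaving it ends in colour `true`; the level is the right
one with probability `1 / L`, and then a unique neighbour is sampled with probability `1/8`. -/
lemma card_roundSeed_le_mul_card_merges {n L : ℕ} (hn : n < 2 ^ L) {G H : SimpleGraph (Fin n)}
    {C : H.ConnectedComponent} (hC : Unfinished G H C) :
    (Fintype.card (RoundSeed n L) : ℝ) ≤
      32 * L * ((Finset.univ.filter fun s : RoundSeed n L => Merges G H s C).card : ℝ) := by
  obtain ⟨v, u, hadj, hv, hu⟩ := hC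
  set rv := Quot.out (H.connectedComponentMk v) with hrv
  set ru := Quot.out (H.connectedComponentMk u) with hru
  have hne : rv ≠ ru := fun h => hu (by
    rw [← hv, ← Quot.out_eq (H.connectedComponentMk u), ← Quot.out_eq (H.connectedComponentMk v),
      ← hrv, ← hru, h])
  set good := Finset.univ.filter fun c : Fin n → Bool =>
    c rv ∈ ({false} : Finset Bool) ∧ c ru ∈ ({true} : Finset Bool) with hgood
  have hgoodc : (good.card : ℝ) = 1 / 4 * 2 ^ n := by
    rw [hgood, card_filter_apply_mem_and_apply_mem hne]
    simp
    ring
  set M : ℝ := ((2 : ℝ) ^ (L + 1)) ^ n with hM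
  have hcolor : ∀ c ∈ good, M ≤ 8 * ∑ p : (Fin n → Fin (2 ^ (L + 1))) × Fin L,
      if Merges G H (c, p) C then (1 : ℝ) else 0 := by
    intro c hc
    obtain ⟨-, hcv, hcu⟩ := Finset.mem_filter.1 hc
    rw [Finset.mem_singleton] at hcv hcu
    set N := Finset.univ.filter fun w => G.Adj v w ∧ componentColor H c w = true with hN
    have hNu : u ∈ N := Finset.mem_filter.2 ⟨Finset.mem_univ _, hadj, hcu⟩
    have hNL : N.card < 2 ^ L :=
      ((Finset.card_le_univ N).trans_eq (Fintype.card_fin n)).trans_lt hn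
    obtain ⟨i, hi⟩ := exists_level N ⟨u, hNu⟩ hNL
    rw [Fintype.card_fin] at hi
    refine hi.trans ?_
    rw [Fintype.sum_prod_type, Finset.natCast_card_filter]
    gcongr with h _
    refine le_trans ?_ (Finset.single_le_sum
      (f := fun j : Fin L => if Merges G H (c, h, j) C then (1 : ℝ) else 0)
      (fun j _ => by split_ifs <;> norm_num) (Finset.mem_univ i))
    split_ifs with h1 h2 h2
    · exact le_rfl
    · refine absurd ?_ h2
      obtain ⟨w, hw⟩ := Finset.card_eq_one.1 h1
      have hmem : ∀ a, (G.Adj v a ∧ componentColor H c a = true) ∧ (h a).val < 2 ^ i.val ↔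
          a = w := by
        intro a
        have := Finset.ext_iff.1 hw a
        simpa [hN] using this
      obtain ⟨⟨hw1, hw2⟩, hw3⟩ := (hmem w).2 rfl
      refine ⟨v, w, hv, hcv, by simp [sample, hw2, hw3], hw1, fun a ha hva => (hmem a).1 ?_⟩
      simp only [sample, Bool.and_eq_true, decide_eq_true_eq] at ha
      exact ⟨⟨hva, ha.1⟩, ha.2⟩
    · norm_num
    · exact le_rfl
  have hcard : (Fintype.card (RoundSeed n L) : ℝ) = 2 ^ n * (M * L) := by
    simp [RoundSeed, hM]
  have hsum : good.card * M ≤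
      8 * ((Finset.univ.filter fun s : RoundSeed n L => Merges G H s C).card : ℝ) := by
    rw [← nsmul_eq_mul, ← Finset.sum_const, Finset.natCast_card_filter, Fintype.sum_prod_type,
      Finset.mul_sum]
    refine (Finset.sum_le_sum hcolor).trans
      (Finset.sum_le_sum_of_subset_of_nonneg (Finset.subset_univ _) fun c _ _ => ?_)
    exact mul_nonneg (by norm_num) (Finset.sum_nonneg fun p _ => by split_ifs <;> norm_num)
  rw [hcard]
  rw [hgoodc] at hsum
  nlinarith [mul_le_mul_of_nonneg_left hsum (Nat.cast_nonneg L : (0 : ℝ) ≤ L)]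

/-- On average, a round lowers the number of unfinished components by the
factor `1 - 1 / (32 L)`. -/
lemma sum_unfinishedCount_roundResult_le {n L : ℕ} (hL : 0 < L) (hn : n < 2 ^ L)
    (G H : SimpleGraph (Fin n)) :
    ∑ s : RoundSeed n L, (unfinishedCount G (roundResult G H s) : ℝ) ≤
      Fintype.card (RoundSeed n L) * ((1 - 1 / (32 * L)) * unfinishedCount G H) := by
  classical
  have hL' : (0 : ℝ) < L := by exact_mod_cast hL
  have hnot : ∀ C : H.ConnectedComponent, Unfinished G H C →
      ((Finset.univ.filter fun s : RoundSeed n L => ¬ Merges G H s C).card : ℝ) ≤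
        Fintype.card (RoundSeed n L) * (1 - 1 / (32 * L)) := by
    intro C hC
    have h1 := card_roundSeed_le_mul_card_merges hn hC
    have h2 := Finset.card_filter_add_card_filter_not (s := (Finset.univ : Finset (RoundSeed n L)))
      (fun s => Merges G H s C)
    rw [Finset.card_univ] at h2
    have h3 : ((Finset.univ.filter fun s : RoundSeed n L => Merges G H s C).card : ℝ) +
      ((Finset.univ.filter fun s : RoundSeed n L => ¬ Merges G H s C).card : ℝ) =
        Fintype.card (RoundSeed n L) := by exact_mod_cast h2
    have h4 : (Fintype.card (RoundSeed n L) : ℝ) * (1 / (32 * L)) ≤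
        ((Finset.univ.filter fun s : RoundSeed n L => Merges G H s C).card : ℝ) := by
      rw [mul_one_div, div_le_iff₀ (by positivity)]
      linarith
    linarith
  calc ∑ s : RoundSeed n L, (unfinishedCount G (roundResult G H s) : ℝ)
      ≤ ∑ s : RoundSeed n L, ((Finset.univ.filter fun C : H.ConnectedComponent =>
          Unfinished G H C ∧ ¬ Merges G H s C).card : ℝ) := by
        gcongr with s
        convert unfinishedCount_roundResult_le G H s
    _ = ∑ C ∈ Finset.univ.filter fun C : H.ConnectedComponent => Unfinished G H C,
          ((Finset.univ.filter fun s : RoundSeed n L => ¬ Merges G H s C).card : ℝ) := by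
        simp_rw [← Finset.filter_filter, Finset.natCast_card_filter]
        rw [Finset.sum_comm]
    _ ≤ ∑ C ∈ Finset.univ.filter fun C : H.ConnectedComponent => Unfinished G H C,
          (Fintype.card (RoundSeed n L) * (1 - 1 / (32 * L)) : ℝ) :=
        Finset.sum_le_sum fun C hC => hnot C (Finset.mem_filter.1 hC).2
    _ = _ := by
        rw [Finset.sum_const, nsmul_eq_mul]
        unfold unfinishedCount
        rw [mul_comm, mul_assoc]

/-! ### The randomized algorithm -/

/-- A spanning forest of `H`. -/
noncomputable def someSpanningForest {V : Type*} (H : SimpleGraph V) : SimpleGraph V :=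
  H.exists_isAcyclic_reachable_eq_le.choose

lemma isSpanningForest_someSpanningForest {V : Type*} {G H : SimpleGraph V} (hH : H ≤ G)
    (h : ∀ u v, G.Reachable u v → H.Reachable u v) :
    IsSpanningForest (someSpanningForest H) G := by
  obtain ⟨h1, h2, h3⟩ := H.exists_isAcyclic_reachable_eq_le.choose_spec
  refine ⟨h1.trans hH, h2, fun u v huv => ?_⟩
  unfold someSpanningForest
  rw [h3]
  exact h u v huv

/-- The algorithm with `T` rounds, as a random function of the graph of the edges known so far. The
random choices of a round do not depend on the known edges, which are known only when the earlier
queries have been answered. -/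
noncomputable def randomRounds (n L : ℕ) [NeZero L] :
    ℕ → PMF (SimpleGraph (Fin n) → MatVecAlg n (SimpleGraph (Fin n)))
  | 0 => PMF.pure fun H => .output (someSpanningForest H)
  | T + 1 => (PMF.uniformOfFintype (RoundSeed n L)).bind fun s =>
      (randomRounds n L T).map fun f H =>
        MatVecAlg.queryList (sliceQueries L (sample H s)) fun ans => f (updateEdges H s ans)

lemma queryCount_of_mem_support_randomRounds {n L : ℕ} [NeZero L]
    (A : Matrix (Fin n) (Fin n) ℝ) {T : ℕ}
    {f : SimpleGraph (Fin n) → MatVecAlg n (SimpleGraph (Fin n))}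
    (hf : f ∈ (randomRounds n L T).support) (H : SimpleGraph (Fin n)) :
    (f H).queryCount A = T * (2 * L) := by
  induction T generalizing f H with
  | zero =>
    rw [randomRounds, PMF.mem_support_pure_iff] at hf
    simp [hf, MatVecAlg.queryCount]
  | succ T ih =>
    rw [randomRounds, PMF.mem_support_bind_iff] at hf
    obtain ⟨s, -, hf⟩ := hf
    rw [PMF.mem_support_map_iff] at hf
    obtain ⟨g, hg, rfl⟩ := hf
    rw [MatVecAlg.queryCount_queryList, ih hg, length_sliceQueries]
    ring

/-- The failure probability is at most the expected number of components that are unfinished after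
the last round. -/
lemma toOuterMeasure_randomRounds_le {n L : ℕ} [NeZero L] (hn : n < 2 ^ L)
    (G : WeightedGraph (Fin n)) (T : ℕ) {H : SimpleGraph (Fin n)} (hH : H ≤ G.graph) :
    (randomRounds n L T).toOuterMeasure
        {f | ¬ IsSpanningForest (MatVecAlg.run G.adjMatrix (f H)) G.graph} ≤
      ENNReal.ofReal ((1 - 1 / (32 * L)) ^ T * unfinishedCount G.graph H) := by
  have hL : 0 < L := Nat.pos_of_ne_zero (NeZero.ne L)
  have hq : (0 : ℝ) ≤ 1 - 1 / (32 * L) := by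
    have : (1 : ℝ) ≤ L := by exact_mod_cast hL
    rw [sub_nonneg, div_le_one (by positivity)]
    linarith
  induction T generalizing H with
  | zero =>
    rw [randomRounds, PMF.toOuterMeasure_pure_apply, pow_zero, one_mul, ENNReal.ofReal_natCast]
    split_ifs with h
    · rw [Nat.one_le_cast, Nat.one_le_iff_ne_zero]
      exact fun h0 => h (isSpanningForest_someSpanningForest hH fun u v =>
        reachable_of_unfinishedCount_eq_zero h0)
    · exact zero_le
  | succ T ih =>
    rw [randomRounds, PMF.toOuterMeasure_bind_apply, tsum_fintype]
    have hcard : (0 : ℝ) < Fintype.card (RoundSeed n L) := by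
      exact_mod_cast Fintype.card_pos
    have step : ∀ s : RoundSeed n L,
        PMF.uniformOfFintype (RoundSeed n L) s *
          ((randomRounds n L T).map fun f H =>
            MatVecAlg.queryList (sliceQueries L (sample H s)) fun ans =>
              f (updateEdges H s ans)).toOuterMeasure
            {f | ¬ IsSpanningForest (MatVecAlg.run G.adjMatrix (f H)) G.graph} ≤
        ENNReal.ofReal ((Fintype.card (RoundSeed n L) : ℝ)⁻¹ *
          ((1 - 1 / (32 * L)) ^ T * unfinishedCount G.graph (roundResult G.graph H s))) := by
      intro s
      rw [ENNReal.ofReal_mul (by positivity), ENNReal.ofReal_inv_of_pos hcard,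
        ENNReal.ofReal_natCast, PMF.uniformOfFintype_apply, PMF.toOuterMeasure_map_apply]
      gcongr
      refine le_trans (le_of_eq ?_) (ih (roundResult_le hH s))
      congr 1
      ext f
      simp only [Set.mem_preimage, Set.mem_ofPred_eq]
      rw [MatVecAlg.run_queryList, updateEdges_answerTable hL hn.le]
    refine (Finset.sum_le_sum fun s _ => step s).trans ?_
    rw [← ENNReal.ofReal_sum_of_nonneg fun s _ => by positivity]
    refine ENNReal.ofReal_le_ofReal ?_
    rw [← Finset.mul_sum, ← Finset.mul_sum, inv_mul_le_iff₀ hcard]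
    calc (1 - 1 / (32 * L) : ℝ) ^ T *
          ∑ s : RoundSeed n L, (unfinishedCount G.graph (roundResult G.graph H s) : ℝ)
        ≤ (1 - 1 / (32 * L)) ^ T * (Fintype.card (RoundSeed n L) *
            ((1 - 1 / (32 * L)) * unfinishedCount G.graph H)) := by
          gcongr
          exact sum_unfinishedCount_roundResult_le hL hn _ _
      _ = _ := by ring

/-! ### The number of rounds -/

/-- `32 L` rounds halve the expected number of unfinished components, so that `32 L (L + 6)` rounds
bring it from at most `n < 2 ^ L` to at most `1 / 64`. -/
lemma pow_mul_le_one_div_fifty {n L : ℕ} (hL : 0 < L) (hn : n < 2 ^ L) :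
    (1 - 1 / (32 * L) : ℝ) ^ (32 * L * (L + 6)) * n ≤ 1 / 50 := by
  have hL' : (1 : ℝ) ≤ L := by exact_mod_cast hL
  have hq : (0 : ℝ) ≤ 1 - 1 / (32 * L) := by
    rw [sub_nonneg, div_le_one (by positivity)]
    linarith
  have half : (1 - 1 / (32 * L) : ℝ) ^ (32 * L) ≤ 1 / 2 := by
    have h1 := Real.one_sub_div_pow_le_exp_neg (n := 32 * L) (t := 1)
      (by push_cast; linarith)
    push_cast at h1
    refine h1.trans ?_
    rw [Real.exp_neg, one_div]
    exact inv_anti₀ two_pos (by linarith [Real.add_one_le_exp (1 : ℝ)])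
  have hn' : (n : ℝ) ≤ 2 ^ L := by exact_mod_cast hn.le
  calc (1 - 1 / (32 * L) : ℝ) ^ (32 * L * (L + 6)) * n
      ≤ (1 / 2) ^ (L + 6) * 2 ^ L := by
        rw [pow_mul]
        gcongr
    _ = 1 / 64 * ((1 / 2) ^ L * 2 ^ L) := by ring
    _ = 1 / 64 := by rw [← mul_pow]; norm_num
    _ ≤ 1 / 50 := by norm_num

lemma natLog_add_one_le {n : ℕ} (hn : 2 ≤ n) :
    ((Nat.log 2 n + 1 : ℕ) : ℝ) ≤ 2 / Real.log 2 * Real.log n := by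
  have h2 : 0 < Real.log 2 := Real.log_pos one_lt_two
  have hle : Real.log 2 ≤ Real.log n :=
    Real.log_le_log two_pos (by exact_mod_cast hn)
  have hpow : (Nat.log 2 n : ℝ) * Real.log 2 ≤ Real.log n := by
    rw [← Real.log_pow]
    refine Real.log_le_log (by positivity) ?_
    exact_mod_cast Nat.pow_log_le_self 2 (by omega)
  rw [div_mul_eq_mul_div, le_div_iff₀ h2]
  push_cast
  linarith

lemma queryBound_le {n : ℕ} (hn : 2 ≤ n) :
    ((32 * (Nat.log 2 n + 1) * (Nat.log 2 n + 1 + 6) * (2 * (Nat.log 2 n + 1)) : ℕ) : ℝ) ≤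
      448 * (2 / Real.log 2) ^ 4 * Real.log n ^ 4 := by
  have h := natLog_add_one_le hn
  set L := Nat.log 2 n + 1 with hL
  have hL1 : (1 : ℝ) ≤ L := by exact_mod_cast (by omega : 1 ≤ L)
  calc ((32 * L * (L + 6) * (2 * L) : ℕ) : ℝ) = 64 * (L : ℝ) ^ 2 * (L + 6) := by push_cast; ring
    _ ≤ 64 * (L : ℝ) ^ 2 * (7 * L) := by gcongr; linarith
    _ = 448 * (L : ℝ) ^ 3 := by ring
    _ ≤ 448 * (L : ℝ) ^ 4 := by gcongr; norm_num
    _ ≤ 448 * (2 / Real.log 2 * Real.log n) ^ 4 := by gcongr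
    _ = _ := by ring

theorem mainTheorem4 :
    ∃ C : ℝ, ∀ n : ℕ, ∃ R : RandomizedMatVecAlg n (SimpleGraph (Fin n)),
      ∀ G : WeightedGraph (Fin n),
        (∀ T ∈ R.support,
          (MatVecAlg.queryCount G.adjMatrix T : ℝ) ≤ C * Real.log n ^ 4) ∧
        R.toOuterMeasure {T | IsSpanningForest (MatVecAlg.run G.adjMatrix T) G.graph} ≥
          49 / 50 := by
  refine ⟨448 * (2 / Real.log 2) ^ 4, fun n => ?_⟩
  rcases Nat.lt_or_ge n 2 with hn | hn
  · -- With at most one vertex no query is allowed, and none is needed.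
    have : Subsingleton (Fin n) := Fin.subsingleton_iff_le_one.2 (by omega)
    refine ⟨PMF.pure (.output ⊥), fun G => ⟨fun T hT => ?_, ?_⟩⟩
    · rw [(PMF.mem_support_pure_iff _ _).1 hT, MatVecAlg.queryCount, Nat.cast_zero]
      positivity
    · have hgood : IsSpanningForest (⊥ : SimpleGraph (Fin n)) G.graph :=
        ⟨bot_le, SimpleGraph.isAcyclic_bot, fun u v _ => Subsingleton.elim u v ▸ .refl _⟩
      rw [PMF.toOuterMeasure_pure_apply, if_pos (by simpa [MatVecAlg.run] using hgood)]
      exact ENNReal.div_le_of_le_mul (by norm_num)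
  · set L := Nat.log 2 n + 1 with hL
    have hnL : n < 2 ^ L := Nat.lt_pow_succ_log_self one_lt_two n
    have : NeZero L := ⟨Nat.succ_ne_zero _⟩
    refine ⟨(randomRounds n L (32 * L * (L + 6))).map fun f => f ⊥, fun G => ⟨fun T hT => ?_, ?_⟩⟩
    · obtain ⟨f, hf, rfl⟩ := (PMF.mem_support_map_iff _ _ _).1 hT
      rw [queryCount_of_mem_support_randomRounds _ hf]
      exact queryBound_le hn
    · rw [PMF.toOuterMeasure_map_apply]
      set P := randomRounds n L (32 * L * (L + 6)) with hP
      set good := {f : SimpleGraph (Fin n) → MatVecAlg n (SimpleGraph (Fin n)) |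
        IsSpanningForest (MatVecAlg.run G.adjMatrix (f ⊥)) G.graph} with hgood
      change 49 / 50 ≤ P.toOuterMeasure good
      have hbad : P.toOuterMeasure goodᶜ ≤ 1 / 50 := by
        refine (toOuterMeasure_randomRounds_le hnL G _ bot_le).trans ?_
        rw [show (1 / 50 : ENNReal) = ENNReal.ofReal (1 / 50) by
          rw [ENNReal.ofReal_div_of_pos (by norm_num)]; norm_num]
        refine ENNReal.ofReal_le_ofReal (le_trans ?_
          (pow_mul_le_one_div_fifty (L := L) (Nat.succ_pos _) hnL))
        have hL' : (1 : ℝ) ≤ L := by exact_mod_cast Nat.succ_pos _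
        have hq : (0 : ℝ) ≤ 1 - 1 / (32 * L) := by
          rw [sub_nonneg, div_le_one (by positivity)]
          linarith
        gcongr
        exact unfinishedCount_le _ _
      have hone : 1 ≤ P.toOuterMeasure good + P.toOuterMeasure goodᶜ := by
        have huniv : P.toOuterMeasure Set.univ = 1 :=
          (PMF.toOuterMeasure_apply_eq_one_iff _ _).2 (Set.subset_univ _)
        rw [← huniv, ← Set.union_compl_self good]
        exact MeasureTheory.measure_union_le _ _
      have hsplit : (49 / 50 : ENNReal) + 1 / 50 = 1 := by
        rw [ENNReal.div_add_div_same, show (49 : ENNReal) + 1 = 50 by norm_num]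
        exact ENNReal.div_self (by norm_num) (by norm_num)
      refine (ENNReal.add_le_add_iff_right (a := 1 / 50) ?_).1 ?_
      · exact ENNReal.div_ne_top (by norm_num) (by norm_num)
      · rw [hsplit]
        exact hone.trans (by gcongr)
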